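/- Let $r\ge 0$, $d\in\mathbb{N}$, let $|\cdot|$ be a norm on $\mathbb{R}^d$, and let $\mathcal{C}=\mathcal{C}([-r,0],\mathbb{R}^d)$ be the Banach space of continuous functions with the norm $\|\phi\|=\sup_{\theta\in[-r,0]}|\phi(\theta)|$. Let $f:\mathbb{R}_+\times\mathcal{C}\to\mathbb{R}^d$ be continuous, where $\mathbb{R}_+=[0,\infty)$, and let $\phi\in\mathcal{C}$. Suppose: (H1) $f$ is continuous in the second variable uniformly with respect to the first one: for every $\xi\in\mathcal{C}$ and $\eta>0$ there is $\rho>0$ such that $|f(t,\xi')-f(t,\xi)|<\eta$ for all $t\ge 0$ and all $\xi'\in\mathcal{C}$ with $\|\xi'-\xi\|<\rho$; (H2) for every bounded set $B\subset\mathcal{C}$, $f$ is bounded on $\mathbb{R}_+\times B$; (H3) for every $\xi\in\mathcal{C}$ the limit $F(\xi):=\lim_{T\to\infty}\frac1T\int_0^T f(t,\xi)\,dt$ exists; (H4) the initial value problem $$\dot y(t)=G(y(t)),\qquad y(0)=\phi(0),\tag{A}$$ considered for $t\ge 0$, has a unique solution. Here $G(v)=F(\tilde v)$ and $\tilde v\in\mathcal{C}$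 is the constant function with value $v\in\mathbb{R}^d$. Uniqueness means that any two solutions agree wherever both are defined. For $\varepsilon>0$ consider the problem $$\dot x(t)=f(t/\varepsilon,x_{t,\varepsilon})\ \ (t\ge 0),\qquad x(t)=\phi(t/\varepsilon)\ \ (t\in[-\varepsilon r,0]),\tag{B}$$ where $x_{t,\varepsilon}\in\mathcal{C}$ is given by $x_{t,\varepsilon}(\theta)=x(t+\varepsilon\theta)$ for $\theta\in[-r,0]$. Solutions of (B) are continuous functions on an interval with left endpoint $-\varepsilon r$ (included) that contains some $t>0$; at $t=0$ the derivative is the right derivative. Let $y$ be the maximal solution of (A), let $J\subset[0,\infty)$ be its interval of definition, and let $L\in J$. Then for every $\delta>0$ there exists $\varepsilon_0=\varepsilon_0(L,\delta)>0$ such that, for all $\varepsilon\in(0,\varepsilon_0]$, every maximal (noncontinuable) solution $x$ of (B) is defined at least on $[-\varepsilon r,L]$ and satisfies $|x(t)-y(t)|<\delta$ for all $t\in[0,L]$. -/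

import Mathlib

open Set Filter Topology

noncomputable section

namespace RFDEAveraging

variable {E : Type*} [NormedAddCommGroup E] [NormedSpace ℝ E]

/-- The Banach space of continuous functions `[-r, 0] → E`, with the sup norm. -/
abbrev Hist (r : ℝ) (E : Type*) [NormedAddCommGroup E] : Type _ := C(Icc (-r) (0 : ℝ), E)

open Classical in
/-- The element `x_{t,ε}` of `Hist r E` given by `x_{t,ε}(θ) = x (t + ε θ)`.
(The value `0` is a placeholder for the case that this is not a continuous function of `θ`; it never
occurs for solutions, see `IsSolution.delayed_apply`.) -/
def delayed (r ε : ℝ) (x : ℝ → E) (t : ℝ) : Hist r E :=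
  if h : Continuous (fun θ : Icc (-r) (0 : ℝ) => x (t + ε * θ)) then ⟨_, h⟩ else 0

/-- `f` is continuous in the second variable, uniformly with respect to the first one. -/
def UniformlyContinuousInState {r : ℝ} (f : ℝ → Hist r E → E) : Prop :=
  ∀ ξ : Hist r E, ∀ η > 0, ∃ ρ > 0, ∀ ξ' : Hist r E, ‖ξ' - ξ‖ < ρ →
    ∀ t, 0 ≤ t → ‖f t ξ' - f t ξ‖ < η

/-- `f` is quasi-bounded in the second variable, uniformly with respect to the first one. -/
def UniformlyQuasiBounded {r : ℝ} (f : ℝ → Hist r E → E) : Prop :=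
  ∀ B : Set (Hist r E), Bornology.IsBounded B → ∃ M : ℝ, ∀ t, 0 ≤ t → ∀ ξ ∈ B, ‖f t ξ‖ ≤ M

/-- `F ξ = lim_{T → ∞} (1/T) ∫₀ᵀ f(t, ξ) dt` for all `ξ`, where all these limits exist. -/
def HasAverage {r : ℝ} (f : ℝ → Hist r E → E) (F : Hist r E → E) : Prop :=
  ∀ ξ : Hist r E, Tendsto (fun T : ℝ => (1 / T) • ∫ t in (0 : ℝ)..T, f t ξ) atTop (𝓝 (F ξ))

/-- `G v = F (ṽ)`, where `ṽ` is the constant function with value `v`. -/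
def averagedField {r : ℝ} (F : Hist r E → E) (v : E) : E := F (ContinuousMap.const _ v)

/-- `x`, with domain the interval `I`, which has the form `[-ε r, b)` or `[-ε r, b]` with
`0 < b ≤ ∞`, solves `x'(t) = f (t / ε, x_{t,ε})` for `t ≥ 0` in `I` (with the right derivative at
`t = 0`) and `x(t) = φ (t / ε)` on `[-ε r, 0]`. Only the values of `x` on `I` matter. -/
structure IsSolution {r : ℝ} (f : ℝ → Hist r E → E) (φ : Hist r E) (ε : ℝ)
    (x : ℝ → E) (I : Set ℝ) : Prop where
  ordConnected : I.OrdConnected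
  subset_Ici : I ⊆ Ici (-(ε * r))
  left_mem : -(ε * r) ∈ I
  exists_pos : ∃ b ∈ I, 0 < b
  continuousOn : ContinuousOn x I
  initial : ∀ θ : Icc (-r) (0 : ℝ), x (ε * θ) = φ θ
  hasDeriv : ∀ t ∈ I, 0 ≤ t → HasDerivWithinAt x (f (t / ε) (delayed r ε x t)) (I ∩ Ici 0) t

/-- A maximal (noncontinuable) solution: no solution on a strictly larger interval extends it. -/
def IsMaximalSolution {r : ℝ} (f : ℝ → Hist r E → E) (φ : Hist r E) (ε : ℝ)
    (x : ℝ → E) (I : Set ℝ) : Prop :=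
  IsSolution f φ ε x I ∧
    ∀ (z : ℝ → E) (K : Set ℝ), IsSolution f φ ε z K → I ⊆ K → EqOn z x I → K = I

/-- For a solution, `delayed` really is the function `θ ↦ x (t + ε θ)`. -/
theorem IsSolution.delayed_apply {r : ℝ} {f : ℝ → Hist r E → E} {φ : Hist r E} {ε : ℝ}
    {x : ℝ → E} {I : Set ℝ} (h : IsSolution f φ ε x I) (hε : 0 < ε) {t : ℝ} (ht : t ∈ I)
    (ht0 : 0 ≤ t) (θ : Icc (-r) (0 : ℝ)) : delayed r ε x t θ = x (t + ε * θ) := by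
  have hc : Continuous (fun θ : Icc (-r) (0 : ℝ) => x (t + ε * θ)) := by
    refine h.continuousOn.comp_continuous (by fun_prop) fun θ => ?_
    refine h.ordConnected.out h.left_mem ht ⟨?_, ?_⟩
    · nlinarith [θ.2.1]
    · nlinarith [θ.2.2]
  simp only [delayed, dif_pos hc, ContinuousMap.coe_mk]

/-- `y`, with domain the interval `J`, which has the form `[0, b)` or `[0, b]` with `0 < b ≤ ∞`,
solves `y' = G(y)`, `y(0) = y₀`. Only the values of `y` on `J` matter. -/
structure IsODESolution (G : E → E) (y₀ : E) (y : ℝ → E) (J : Set ℝ) : Prop where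
  ordConnected : J.OrdConnected
  subset_Ici : J ⊆ Ici 0
  zero_mem : (0 : ℝ) ∈ J
  exists_pos : ∃ b ∈ J, 0 < b
  initial : y 0 = y₀
  hasDeriv : ∀ t ∈ J, HasDerivWithinAt y (G (y t)) J t

/-- A maximal (noncontinuable) solution: no solution on a strictly larger interval extends it. -/
def IsMaximalODESolution (G : E → E) (y₀ : E) (y : ℝ → E) (J : Set ℝ) : Prop :=
  IsODESolution G y₀ y J ∧
    ∀ (z : ℝ → E) (K : Set ℝ), IsODESolution G y₀ z K → J ⊆ K → EqOn z y J → K = J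

/-- The problem `y' = G(y)`, `y(0) = y₀` has a solution, and any two solutions agree wherever both
are defined. -/
def HasUniqueODESolution (G : E → E) (y₀ : E) : Prop :=
  (∃ y J, IsODESolution G y₀ y J) ∧
    ∀ y₁ J₁ y₂ J₂, IsODESolution G y₀ y₁ J₁ → IsODESolution G y₀ y₂ J₂ → EqOn y₁ y₂ (J₁ ∩ J₂)

end RFDEAveraging

end

/-!
The proof is by compactness. If the assertion fails, there are `ε n → 0` and noncontinuable
solutions `x n` that leave the `δ`-tube around `y` or end before time `L`. A solution that stays
bounded up to time `L` does not end there: it is Lipschitz, hence extends continuously to the right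
end of its interval, and Peano's theorem for retarded equations (`exists_continuation`, proved with
Tonelli's delayed approximations) continues it further. So every `x n` reaches distance `δ` from
`y` at a first time `τ n ≤ L` (`IsMaximalSolution.exists_exit`). Up to that time the `x n` are
bounded, hence Lipschitz with a common constant, and by Arzelà–Ascoli a subsequence converges
locally uniformly to some `z`, with `τ n → σ` along it.

The limit solves the averaged equation on `[0, σ]` (`hasDerivWithinAt_of_tendsto`). Near a time
`t` the histories of `x n` are close to the constant history `ξ` with value `z t`, because their
time window has length `ε n * r`. As `f` is continuous in the state uniformly in time, the
increments of `x n` over `[a, b]` differ from `∫ₐᵇ f(s / ε n, ξ) ds` by at most `η (b - a)`, and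
after rescaling time this integral tends to `(b - a) F(ξ)` by the existence of averages. Hence
`z b - z a` differs from `(b - a) G(z t)` by at most `η (b - a)`, which says that `z' = G(z)` at `t`.
Uniqueness gives `z = y` on `[0, σ]`, while `‖z σ - y σ‖ ≥ δ` by
the choice of `τ n`; if `σ = 0`, equal initial values give the same contradiction.
-/

noncomputable section

namespace RFDEAveraging

variable {E : Type*} [NormedAddCommGroup E]

/-! ### Histories and the right-hand side -/

theorem delayed_congr {r ε : ℝ} {x z : ℝ → E} {t : ℝ}
    (h : ∀ θ : Icc (-r) (0 : ℝ), x (t + ε * θ) = z (t + ε * θ)) :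
    delayed r ε x t = delayed r ε z t := by
  have h' : (fun θ : Icc (-r) (0 : ℝ) => x (t + ε * θ)) =
      fun θ : Icc (-r) (0 : ℝ) => z (t + ε * θ) := funext h
  by_cases hc : Continuous fun θ : Icc (-r) (0 : ℝ) => x (t + ε * θ)
  · rw [delayed, delayed, dif_pos hc, dif_pos (h' ▸ hc)]
    exact ContinuousMap.ext h
  · rw [delayed, delayed, dif_neg hc, dif_neg (h' ▸ hc)]

theorem delayed_apply_of_continuous {r ε : ℝ} {x : ℝ → E} (hx : Continuous x) (t : ℝ)
    (θ : Icc (-r) (0 : ℝ)) : delayed r ε x t θ = x (t + ε * θ) := by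
  have hc : Continuous (fun θ : Icc (-r) (0 : ℝ) => x (t + ε * θ)) := by fun_prop
  simp only [delayed, dif_pos hc, ContinuousMap.coe_mk]

theorem norm_delayed_le {r ε : ℝ} {x : ℝ → E} {t R : ℝ} (hR : 0 ≤ R)
    (h : ∀ θ : Icc (-r) (0 : ℝ), ‖x (t + ε * θ)‖ ≤ R) : ‖delayed r ε x t‖ ≤ R := by
  rw [delayed]
  split_ifs with hc
  · exact (ContinuousMap.norm_le _ hR).2 h
  · simpa using hR

/-- The history depends continuously on the function (in the topology of locally uniform
convergence) and the time jointly. -/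
theorem continuous_delayed_uncurry (r ε : ℝ) :
    Continuous fun p : C(ℝ, E) × ℝ => delayed r ε p.1 p.2 := by
  have h1 : Continuous fun p : C(ℝ, E) × ℝ =>
      (⟨fun θ : Icc (-r) (0 : ℝ) => p.2 + ε * θ, by fun_prop⟩ : C(Icc (-r) (0 : ℝ), ℝ)) := by
    refine ContinuousMap.continuous_of_continuous_uncurry _ ?_
    simp only [Function.uncurry_def, ContinuousMap.coe_mk]
    fun_prop
  refine (ContinuousMap.continuous_comp'.comp (h1.prodMk continuous_fst)).congr fun p => ?_
  ext θ
  rw [delayed_apply_of_continuous p.1.continuous]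
  rfl

theorem continuous_delayed (r ε : ℝ) {x : ℝ → E} (hx : Continuous x) :
    Continuous (delayed r ε x) :=
  (continuous_delayed_uncurry r ε).comp (Continuous.prodMk_right (⟨x, hx⟩ : C(ℝ, E)))

theorem norm_delayed_sub_const_le {r ε : ℝ} (hε : 0 ≤ ε) {u : ℝ → E} {K : NNReal}
    (hu : LipschitzWith K u) (t s : ℝ) (v : E) {C : ℝ}
    (hC : K * (|s - t| + ε * r) + ‖u t - v‖ ≤ C) (hC0 : 0 ≤ C) :
    ‖delayed r ε u s - ContinuousMap.const _ v‖ ≤ C := by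
  refine (ContinuousMap.norm_le _ hC0).2 fun θ => le_trans ?_ hC
  rw [ContinuousMap.sub_apply, delayed_apply_of_continuous hu.continuous,
    ContinuousMap.const_apply]
  refine (norm_sub_le_norm_sub_add_norm_sub _ (u t) _).trans ?_
  gcongr
  refine (hu.norm_sub_le _ _).trans ?_
  gcongr
  rw [Real.norm_eq_abs, add_sub_right_comm]
  refine (abs_add_le _ _).trans ?_
  gcongr
  rw [abs_mul, abs_of_nonneg hε]
  gcongr
  exact abs_le.2 ⟨by linarith [θ.2.1], θ.2.2.trans (by linarith [θ.2.1, θ.2.2])⟩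

/-- Since `f` is continuous for nonnegative times only, the right-hand side is frozen at its value
at time `0` for negative times. -/
theorem continuous_rhs {r ε : ℝ} (hε : 0 < ε) {f : ℝ → Hist r E → E}
    (hf : ContinuousOn (Function.uncurry f) (Ici 0 ×ˢ univ)) :
    Continuous (Function.uncurry fun s ψ => f (max s 0 / ε) ψ) := by
  have h : Continuous fun q : ℝ × Hist r E => (max q.1 0 / ε, q.2) := by fun_prop
  exact hf.comp_continuous h fun q => ⟨div_nonneg (le_max_right _ _) hε.le, mem_univ _⟩

theorem continuous_rhs_delayed {r ε : ℝ} (hε : 0 < ε) {f : ℝ → Hist r E → E}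
    (hf : ContinuousOn (Function.uncurry f) (Ici 0 ×ˢ univ)) {z : ℝ → E} (hz : Continuous z) :
    Continuous fun s => f (max s 0 / ε) (delayed r ε z s) :=
  (continuous_rhs hε hf).comp (continuous_id.prodMk (continuous_delayed r ε hz))

variable [NormedSpace ℝ E]

/-! ### Compactness of sets of Lipschitz functions -/

theorem isCompact_setOf_lipschitzWith [FiniteDimensional ℝ E] (K : NNReal) (b : ℝ) (q : E) :
    IsCompact {v : C(ℝ, E) | LipschitzWith K v ∧ v b = q} := by
  have : ProperSpace E := FiniteDimensional.proper ℝ E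
  refine ArzelaAscoli.isCompact_of_equicontinuous _ ?_
    (LipschitzWith.uniformEquicontinuous _ K fun v => v.2.1).equicontinuous
  have himg : ContinuousMap.toFun '' {v : C(ℝ, E) | LipschitzWith K v ∧ v b = q}
      = {v : ℝ → E | LipschitzWith K v ∧ v b = q} := by
    ext v
    constructor
    · rintro ⟨w, hw, rfl⟩
      exact hw
    · intro hv
      exact ⟨⟨v, hv.1.continuous⟩, hv, rfl⟩
  rw [himg]
  refine (isCompact_univ_pi fun t : ℝ => isCompact_closedBall q (K * dist t b)).of_isClosed_subset
    ?_ ?_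
  · simp only [lipschitzWith_iff_dist_le_mul, ofPred_and, ofPred_forall]
    refine IsClosed.inter (isClosed_iInter fun s => isClosed_iInter fun t => ?_) ?_
    · exact isClosed_le ((continuous_apply s).dist (continuous_apply t)) continuous_const
    · exact isClosed_eq (continuous_apply b) continuous_const
  · rintro v ⟨hv, hvb⟩ t -
    rw [Metric.mem_closedBall, ← hvb]
    exact hv.dist_le_mul t b

/-! ### Local existence for retarded equations -/

/-- The Volterra operator of a retarded equation whose right-hand side is evaluated `d` time units
too late: the integral part of a solution that continues the function `u` beyond time `b`. -/
def tonelliIntegral {r : ℝ} (ε : ℝ) (g : ℝ → Hist r E → E) (b d : ℝ) (u : ℝ → E) (t : ℝ) : E :=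
  ∫ s in b..max t b, g s (delayed r ε u (s - d))

theorem lipschitzWith_tonelliIntegral {r ε : ℝ} {g : ℝ → Hist r E → E}
    (hg : Continuous (Function.uncurry g)) {M : NNReal} (hM : ∀ s ψ, ‖g s ψ‖ ≤ M) (b d : ℝ)
    {u : ℝ → E} (hu : Continuous u) : LipschitzWith M (tonelliIntegral ε g b d u) := by
  have hc : Continuous fun s => g s (delayed r ε u (s - d)) :=
    hg.comp (continuous_id.prodMk ((continuous_delayed r ε hu).comp (continuous_sub_right d)))
  refine LipschitzWith.of_dist_le_mul fun t t' => ?_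
  rw [dist_eq_norm, tonelliIntegral, tonelliIntegral,
    intervalIntegral.integral_interval_sub_left (hc.intervalIntegrable _ _)
      (hc.intervalIntegrable _ _)]
  refine (intervalIntegral.norm_integral_le_of_norm_le_const fun s _ => hM s _).trans ?_
  gcongr
  rw [Real.dist_eq]
  simpa using abs_max_sub_max_le_abs t t' b

/-- Tonelli's approximate solutions. With a delay `d > 0` in the right-hand side, iterating the
Volterra operator determines the solution on `(-∞, b + m d]` after `m` steps, so no fixed point
theorem is needed. -/
theorem exists_tonelli_approx {r ε : ℝ} (hε : 0 < ε) {g : ℝ → Hist r E → E}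
    (hg : Continuous (Function.uncurry g)) {M : NNReal} (hM : ∀ s ψ, ‖g s ψ‖ ≤ M) (b : ℝ)
    (p : C(ℝ, E)) {d : ℝ} (hd : 0 < d) :
    ∃ v : C(ℝ, E), LipschitzWith M v ∧ v b = 0 ∧
      ∀ t ≤ b + 1, v t = tonelliIntegral ε g b d (p + v) t := by
  let T : C(ℝ, E) → C(ℝ, E) := fun u =>
    ⟨tonelliIntegral ε g b d u, (lipschitzWith_tonelliIntegral hg hM b d u.continuous).continuous⟩
  let u : ℕ → C(ℝ, E) := fun m => (fun w => p + T w)^[m] p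
  have hu : ∀ m, u (m + 1) = p + T (u m) := fun m => Function.iterate_succ_apply' _ _ _
  have hstep : ∀ m : ℕ, ∀ t ≤ b + m * d, u (m + 1) t = u m t := by
    intro m
    induction m with
    | zero =>
      intro t ht
      have ht' : max t b = b := max_eq_right (by simpa using ht)
      simp [hu, T, u, tonelliIntegral, ht']
    | succ m ih =>
      intro t ht
      rw [hu (m + 1), congrArg (fun w : C(ℝ, E) => w t) (hu m)]
      simp only [ContinuousMap.add_apply]
      congr 1
      refine intervalIntegral.integral_congr fun s hs => ?_
      rw [uIcc_of_le (le_max_right _ _)] at hs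
      refine congrArg (g s) (delayed_congr fun θ => ih _ ?_)
      have h1 : ε * (θ : ℝ) ≤ 0 := mul_nonpos_of_nonneg_of_nonpos hε.le θ.2.2
      have h2 : s ≤ b + (m + 1) * d := by
        refine hs.2.trans (max_le (by simpa using ht) ?_)
        have : 0 ≤ ((m : ℝ) + 1) * d := by positivity
        linarith
      linarith
  obtain ⟨m, hm⟩ := exists_nat_ge (1 / d)
  have hm' : 1 ≤ m * d := (div_le_iff₀ hd).1 hm
  refine ⟨T (u m), lipschitzWith_tonelliIntegral hg hM b d (u m).continuous, ?_, fun t ht => ?_⟩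
  · simp [T, tonelliIntegral]
  · rw [← ContinuousMap.coe_add, ← hu]
    refine intervalIntegral.integral_congr fun s hs => ?_
    rw [uIcc_of_le (le_max_right _ _)] at hs
    refine congrArg (g s) (delayed_congr fun θ => (hstep m _ ?_).symm)
    have h1 : ε * (θ : ℝ) ≤ 0 := mul_nonpos_of_nonneg_of_nonpos hε.le θ.2.2
    have h2 : s ≤ b + 1 := hs.2.trans (max_le ht (by linarith))
    linarith

/-- Peano's theorem for a bounded right-hand side: the Tonelli approximations have a limit point,
which solves the integral equation. -/
theorem exists_continuation_of_bounded [FiniteDimensional ℝ E] {r ε : ℝ} (hε : 0 < ε)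
    {g : ℝ → Hist r E → E} (hg : Continuous (Function.uncurry g)) {M : NNReal}
    (hM : ∀ s ψ, ‖g s ψ‖ ≤ M) (b : ℝ) {x : ℝ → E} (hx : Continuous x) :
    ∃ z : ℝ → E, Continuous z ∧ EqOn z x (Iic b) ∧
      ∀ t ∈ Icc b (b + 1), z t = x b + ∫ s in b..t, g s (delayed r ε z s) := by
  have := FiniteDimensional.complete ℝ E
  let p : C(ℝ, E) := ⟨fun t => x (min t b), by fun_prop⟩
  let d : ℕ → ℝ := fun n => 1 / ((n : ℝ) + 1)
  have hd : ∀ n, 0 < d n := fun n => Nat.one_div_pos_of_nat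
  have hd0 : Tendsto d atTop (𝓝 0) := tendsto_one_div_add_atTop_nhds_zero_nat
  choose v hvL hvb hv using fun n => exists_tonelli_approx hε hg hM b p (hd n)
  obtain ⟨w, -, ψ, hψ, hlim⟩ :=
    (isCompact_setOf_lipschitzWith (E := E) M b 0).tendsto_subseq fun n => ⟨hvL n, hvb n⟩
  have heval : ∀ t, Tendsto (fun n => v (ψ n) t) atTop (𝓝 (w t)) := fun t =>
    ((continuous_eval_const (F := C(ℝ, E)) t).tendsto w).comp hlim
  have heq : ∀ t ≤ b + 1, w t = ∫ s in b..max t b, g s (delayed r ε (p + w : C(ℝ, E)) s) := by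
    intro t ht
    refine tendsto_nhds_unique (heval t) ?_
    simp only [fun n => hv (ψ n) t ht]
    refine intervalIntegral.tendsto_integral_filter_of_dominated_convergence (fun _ => (M : ℝ))
      (Eventually.of_forall fun n => ?_)
      (Eventually.of_forall fun n => Eventually.of_forall fun s _ => hM s _)
      intervalIntegrable_const (Eventually.of_forall fun s _ => ?_)
    · exact (hg.comp (continuous_id.prodMk ((continuous_delayed r ε
        (p + v (ψ n)).continuous).comp
          (continuous_sub_right (d (ψ n)))))).aestronglyMeasurable
    · have h1 : Tendsto (fun n => ((p + v (ψ n) : C(ℝ, E)), s - d (ψ n))) atTop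
          (𝓝 ((p + w : C(ℝ, E)), s)) := by
        refine (tendsto_const_nhds.add hlim).prodMk_nhds ?_
        simpa using (tendsto_const_nhds (x := s)).sub (hd0.comp hψ.tendsto_atTop)
      exact (hg.tendsto (s, delayed r ε (p + w : C(ℝ, E)) s)).comp
        (tendsto_const_nhds.prodMk_nhds (((continuous_delayed_uncurry r ε).tendsto _).comp h1))
  refine ⟨(p + w : C(ℝ, E)), (p + w).continuous, fun t ht => ?_, fun t ht => ?_⟩
  · have hw : w t = 0 := by
      rw [heq t (by have := mem_Iic.1 ht; linarith), max_eq_right ht,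
        intervalIntegral.integral_same]
    simp [p, hw, min_eq_left (mem_Iic.1 ht)]
  · have hw := heq t ht.2
    rw [max_eq_left ht.1] at hw
    rw [← hw]
    simp [p, min_eq_right ht.1]

/-- Peano's theorem for retarded equations: local continuation beyond time `b`. The state is
retracted radially to a ball, which makes the right-hand side bounded and changes nothing as long as
the history stays in the ball. -/
theorem exists_continuation [FiniteDimensional ℝ E] {r ε : ℝ} (hε : 0 < ε)
    {g : ℝ → Hist r E → E} (hg : Continuous (Function.uncurry g))
    (hbdd : ∀ R : ℝ, ∃ M : ℝ, ∀ s ψ, ‖ψ‖ ≤ R → ‖g s ψ‖ ≤ M) (b : ℝ) {x : ℝ → E}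
    (hx : Continuous x) :
    ∃ z : ℝ → E, ∃ c > b, Continuous z ∧ EqOn z x (Iic b) ∧
      ∀ t ∈ Icc b c, z t = x b + ∫ s in b..t, g s (delayed r ε z s) := by
  let R : ℝ := ‖delayed r ε x b‖ + 1
  have hR : 0 < R := by positivity
  have hmax : ∀ ψ : Hist r E, 0 < max R ‖ψ‖ := fun ψ => lt_max_of_lt_left hR
  let ρ : Hist r E → Hist r E := fun ψ => (R / max R ‖ψ‖) • ψ
  have hρc : Continuous ρ := by
    refine (continuous_const.div (by fun_prop) fun ψ => (hmax ψ).ne').smul continuous_id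
  have hρn : ∀ ψ, ‖ρ ψ‖ ≤ R := by
    intro ψ
    rw [norm_smul, Real.norm_of_nonneg (div_nonneg hR.le (hmax ψ).le), div_mul_eq_mul_div,
      div_le_iff₀ (hmax ψ)]
    gcongr
    exact le_max_right _ _
  have hρe : ∀ ψ, ‖ψ‖ ≤ R → ρ ψ = ψ := by
    intro ψ hψ
    simp only [ρ, max_eq_left hψ, div_self hR.ne', one_smul]
  obtain ⟨M, hM⟩ := hbdd R
  obtain ⟨z, hz, hzx, hzi⟩ := exists_continuation_of_bounded (g := fun s ψ => g s (ρ ψ)) hε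
    (hg.comp (continuous_fst.prodMk (hρc.comp continuous_snd))) (M := M.toNNReal)
    (fun s ψ => (hM s _ (hρn ψ)).trans (Real.le_coe_toNNReal M)) b hx
  have hb : delayed r ε z b = delayed r ε x b := by
    refine delayed_congr fun θ => hzx ?_
    have h1 : ε * (θ : ℝ) ≤ 0 := mul_nonpos_of_nonneg_of_nonpos hε.le θ.2.2
    simpa using h1
  have hev : ∀ᶠ s in 𝓝 b, ‖delayed r ε z s‖ < R := by
    refine (continuous_delayed r ε hz).norm.continuousAt.eventually_lt continuousAt_const ?_
    rw [hb]
    exact lt_add_one _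
  obtain ⟨η, hη, hball⟩ := Metric.eventually_nhds_iff.1 hev
  refine ⟨z, b + min 1 (η / 2), by simp [hη], hz, hzx, fun t ht => ?_⟩
  have hm1 : min 1 (η / 2) ≤ 1 := min_le_left _ _
  have hm2 : min 1 (η / 2) ≤ η / 2 := min_le_right _ _
  rw [hzi t ⟨ht.1, by linarith [ht.2]⟩]
  congr 1
  refine intervalIntegral.integral_congr fun s hs => ?_
  rw [uIcc_of_le ht.1] at hs
  rw [hρe _ (hball _).le]
  rw [Real.dist_eq, abs_of_nonneg (by linarith [hs.1])]
  linarith [hs.2, ht.2]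

/-! ### Solutions and their continuation -/

/-- The integral form of the equation yields a solution on `[-ε r, c]`; `IsSolution.integral_eq` is
the converse. -/
theorem isSolution_of_integral_eq [CompleteSpace E] {r ε : ℝ} (hr : 0 ≤ r) (hε : 0 < ε)
    {f : ℝ → Hist r E → E} (hf : ContinuousOn (Function.uncurry f) (Ici 0 ×ˢ univ))
    {φ : Hist r E} {z : ℝ → E} (hz : Continuous z)
    (hφ : ∀ θ : Icc (-r) (0 : ℝ), z (ε * θ) = φ θ) {c : ℝ} (hc : 0 < c)
    (hint : ∀ t ∈ Icc 0 c, z t = z 0 + ∫ s in (0 : ℝ)..t, f (max s 0 / ε) (delayed r ε z s)) :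
    IsSolution f φ ε z (Icc (-(ε * r)) c) := by
  have hεr : 0 ≤ ε * r := mul_nonneg hε.le hr
  refine ⟨ordConnected_Icc, Icc_subset_Ici_self, ⟨le_rfl, by linarith⟩,
    ⟨c, ⟨by linarith, le_rfl⟩, hc⟩, hz.continuousOn, hφ, fun t ht ht0 => ?_⟩
  have hsub : Icc (-(ε * r)) c ∩ Ici 0 ⊆ Icc 0 c := fun s hs => ⟨hs.2, hs.1.2⟩
  have hd := ((continuous_rhs_delayed hε hf hz).integral_hasStrictDerivAt 0 t).hasDerivAt
  simp only [max_eq_left ht0] at hd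
  exact ((hd.const_add (z 0)).hasDerivWithinAt.congr (fun s hs => hint s hs)
    (hint t ⟨ht0, ht.2⟩)).mono hsub

namespace IsSolution

variable {r ε : ℝ} {f : ℝ → Hist r E → E} {φ : Hist r E} {x : ℝ → E} {I : Set ℝ}

theorem Icc_subset (h : IsSolution f φ ε x I) {t : ℝ} (ht : t ∈ I) : Icc (-(ε * r)) t ⊆ I :=
  h.ordConnected.out h.left_mem ht

theorem zero_mem (hr : 0 ≤ r) (hε : 0 < ε) (h : IsSolution f φ ε x I) : (0 : ℝ) ∈ I := by
  obtain ⟨b, hb, hb0⟩ := h.exists_pos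
  exact h.Icc_subset hb ⟨neg_nonpos.2 (mul_nonneg hε.le hr), hb0.le⟩

theorem add_mem (hε : 0 < ε) (h : IsSolution f φ ε x I) {t : ℝ} (ht : t ∈ I) (ht0 : 0 ≤ t)
    (θ : Icc (-r) (0 : ℝ)) : t + ε * θ ∈ I := by
  refine h.Icc_subset ht ⟨?_, ?_⟩
  · nlinarith [θ.2.1]
  · nlinarith [θ.2.2]

theorem delayed_eq (hε : 0 < ε) (h : IsSolution f φ ε x I) {z : ℝ → E} (hzx : EqOn z x I)
    {t : ℝ} (ht : t ∈ I) (ht0 : 0 ≤ t) : delayed r ε z t = delayed r ε x t :=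
  delayed_congr fun θ => hzx (h.add_mem hε ht ht0 θ)

theorem hasDerivAt (h : IsSolution f φ ε x I) {z : ℝ → E} {s t : ℝ} (ht : t ∈ I) (hs0 : 0 < s)
    (hst : s < t) (hr : 0 ≤ ε * r) (hzx : EqOn z x (Icc 0 t)) :
    HasDerivAt z (f (s / ε) (delayed r ε x s)) s := by
  have hsub : Icc 0 t ⊆ I ∩ Ici 0 := fun u hu =>
    ⟨h.Icc_subset ht ⟨by linarith [hu.1], hu.2⟩, hu.1⟩
  exact (((h.hasDeriv s (hsub ⟨hs0.le, hst.le⟩).1 hs0.le).mono hsub).congr hzx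
    (hzx ⟨hs0.le, hst.le⟩)).hasDerivAt (Icc_mem_nhds hs0 hst)

theorem integral_eq [CompleteSpace E] (hr : 0 ≤ r) (hε : 0 < ε)
    (hf : ContinuousOn (Function.uncurry f) (Ici 0 ×ˢ univ)) (h : IsSolution f φ ε x I)
    {z : ℝ → E} (hz : Continuous z) (hzx : EqOn z x I) {t : ℝ} (ht : t ∈ I) (ht0 : 0 ≤ t) :
    z t = z 0 + ∫ s in (0 : ℝ)..t, f (max s 0 / ε) (delayed r ε z s) := by
  have hεr : 0 ≤ ε * r := mul_nonneg hε.le hr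
  have hsub : Icc 0 t ⊆ I := (Icc_subset_Icc_left (by linarith)).trans (h.Icc_subset ht)
  rw [intervalIntegral.integral_eq_sub_of_hasDeriv_right_of_le ht0 hz.continuousOn
    (fun s hs => ?_) ((continuous_rhs_delayed hε hf hz).intervalIntegrable _ _), add_sub_cancel]
  rw [max_eq_left hs.1.le, h.delayed_eq hε hzx (hsub ⟨hs.1.le, hs.2.le⟩) hs.1.le]
  exact (h.hasDerivAt ht hs.1 hs.2 hεr (hzx.mono hsub)).hasDerivWithinAt

theorem lipschitzOnWith (hε : 0 < ε) (h : IsSolution f φ ε x I) {τ R : ℝ} {M : NNReal}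
    (hR0 : 0 ≤ R) (hR : ∀ t ∈ I, t ≤ τ → ‖x t‖ ≤ R)
    (hM : ∀ t, 0 ≤ t → ∀ ξ : Hist r E, ‖ξ‖ ≤ R → ‖f t ξ‖ ≤ M) :
    LipschitzOnWith M x (I ∩ Icc 0 τ) := by
  have hsub : I ∩ Icc 0 τ ⊆ I ∩ Ici 0 := inter_subset_inter_right _ Icc_subset_Ici_self
  have hconv : Convex ℝ (I ∩ Icc 0 τ) := (h.ordConnected.inter ordConnected_Icc).convex
  refine hconv.lipschitzOnWith_of_nnnorm_hasDerivWithin_le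
    (fun t ht => (h.hasDeriv t ht.1 ht.2.1).mono hsub) fun t ht => ?_
  refine hM _ (div_nonneg ht.2.1 hε.le) _ (norm_delayed_le hR0 fun θ => ?_)
  refine hR _ (h.add_mem hε ht.1 ht.2.1 θ) ?_
  nlinarith [θ.2.2, ht.2.2]

/-- A solution that is Lipschitz for nonnegative times is the restriction of a continuous function
on the line; in particular it has a limit at the right end of its interval. -/
theorem exists_continuous_extension [FiniteDimensional ℝ E] (hr : 0 ≤ r) (hε : 0 < ε)
    (h : IsSolution f φ ε x I) {M : NNReal} (hM : LipschitzOnWith M x (I ∩ Ici 0)) :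
    ∃ z : ℝ → E, Continuous z ∧ EqOn z x I := by
  obtain ⟨w, hw, hwx⟩ := hM.extend_finite_dimension
  have hr' : -r ≤ 0 := neg_nonpos.2 hr
  have h0 := h.zero_mem hr hε
  have hφ0 : φ (projIcc (-r) 0 hr' 0) = w 0 := by
    rw [projIcc_of_right_le hr' le_rfl, ← hwx ⟨h0, self_mem_Ici⟩, ← h.initial, mul_zero]
  refine ⟨fun t => w (max t 0) + (φ (projIcc (-r) 0 hr' (t / ε)) - w 0), ?_, fun t ht => ?_⟩
  · have := hw.continuous
    fun_prop
  · rcases le_total 0 t with h0t | ht0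
    · simp only
      rw [projIcc_of_right_le hr' (div_nonneg h0t hε.le), ← projIcc_of_right_le hr' le_rfl, hφ0,
        sub_self, add_zero, max_eq_left h0t]
      exact (hwx ⟨ht, h0t⟩).symm
    · have h1 : -r ≤ t / ε := by
        rw [le_div_iff₀ hε]
        linarith [mem_Ici.1 (h.subset_Ici ht)]
      have h2 : t / ε ≤ 0 := div_nonpos_of_nonpos_of_nonneg ht0 hε.le
      simp only [max_eq_right ht0, add_sub_cancel]
      rw [projIcc_of_mem hr' ⟨h1, h2⟩, ← h.initial, mul_div_cancel₀ _ hε.ne']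

end IsSolution

/-- A noncontinuable solution that stays bounded up to time `L` is defined at time `L`. -/
theorem IsMaximalSolution.mem_of_bounded [FiniteDimensional ℝ E] {r ε : ℝ} (hr : 0 ≤ r)
    (hε : 0 < ε) {f : ℝ → Hist r E → E}
    (hf : ContinuousOn (Function.uncurry f) (Ici 0 ×ˢ univ)) (h2 : UniformlyQuasiBounded f)
    {φ : Hist r E} {x : ℝ → E} {I : Set ℝ} (h : IsMaximalSolution f φ ε x I) {L R : ℝ}
    (hL : 0 ≤ L) (hR : ∀ t ∈ I, t ≤ L → ‖x t‖ ≤ R) : L ∈ I := by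
  have := FiniteDimensional.complete ℝ E
  obtain ⟨hx, hmax⟩ := h
  by_contra hLI
  have hεr : 0 ≤ ε * r := mul_nonneg hε.le hr
  have hlt : ∀ t ∈ I, t < L := fun t ht => by
    by_contra hge
    exact hLI (hx.Icc_subset ht ⟨by linarith, not_lt.1 hge⟩)
  have hbdd : ∀ R : ℝ, ∃ M : ℝ, ∀ t, 0 ≤ t → ∀ ξ : Hist r E, ‖ξ‖ ≤ R → ‖f t ξ‖ ≤ M := by
    intro R
    obtain ⟨M, hM⟩ := h2 _ (Metric.isBounded_closedBall (x := (0 : Hist r E)) (r := R))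
    exact ⟨M, fun t ht ξ hξ => hM t ht ξ (mem_closedBall_zero_iff.2 hξ)⟩
  have h0 := hx.zero_mem hr hε
  obtain ⟨M, hM⟩ := hbdd R
  have hLip := hx.lipschitzOnWith (M := M.toNNReal) hε ((norm_nonneg _).trans (hR 0 h0 hL)) hR
    fun t ht ξ hξ => (hM t ht ξ hξ).trans (Real.le_coe_toNNReal M)
  obtain ⟨w, hw, hwx⟩ := hx.exists_continuous_extension hr hε
    (hLip.mono fun t ht => ⟨ht.1, ht.2, (hlt t ht.1).le⟩)
  have hbddI : BddAbove I := ⟨L, fun t ht => (hlt t ht).le⟩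
  set b := sSup I with hb
  have hIb : ∀ t ∈ I, t ≤ b := fun t ht => le_csSup hbddI ht
  have hlub : IsLUB I b := isLUB_csSup ⟨0, h0⟩ hbddI
  obtain ⟨b₀, hb₀, hb₀pos⟩ := hx.exists_pos
  have hbpos : 0 < b := hb₀pos.trans_le (hIb _ hb₀)
  -- The integral equation passes from `I` to the right end of `I`, which may fail to lie in `I`.
  have hwint : ∀ t ∈ Icc 0 b,
      w t = w 0 + ∫ s in (0 : ℝ)..t, f (max s 0 / ε) (delayed r ε w s) := by
    have hclosed : IsClosed {t | w t = w 0 + ∫ s in (0 : ℝ)..t,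
        f (max s 0 / ε) (delayed r ε w s)} :=
      isClosed_eq hw (continuous_const.add (intervalIntegral.continuous_primitive
        (fun _ _ => (continuous_rhs_delayed hε hf hw).intervalIntegrable _ _) 0))
    have hIco : Ico 0 b ⊆ {t | w t = w 0 + ∫ s in (0 : ℝ)..t,
        f (max s 0 / ε) (delayed r ε w s)} := fun t ht => by
      obtain ⟨s, hs, hts⟩ := (lt_isLUB_iff hlub).1 ht.2
      exact hx.integral_eq hr hε hf hw hwx (hx.Icc_subset hs ⟨by linarith [ht.1], hts.le⟩) ht.1
    rw [← closure_Ico hbpos.ne]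
    exact closure_minimal hIco hclosed
  obtain ⟨z, c, hbc, hz, hzw, hzint⟩ := exists_continuation hε (continuous_rhs hε hf)
    (fun R => (hbdd R).imp fun M hM s ψ hψ => hM _ (div_nonneg (le_max_right _ _) hε.le) ψ hψ)
    b hw
  have hzI : EqOn z x I := fun t ht => (hzw (hIb t ht)).trans (hwx ht)
  have hcont := continuous_rhs_delayed (r := r) hε hf hz
  have hzsol : IsSolution f φ ε z (Icc (-(ε * r)) c) := by
    refine isSolution_of_integral_eq hr hε hf hz (fun θ => ?_) (hbpos.trans hbc) fun t ht => ?_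
    · have := hx.add_mem hε h0 le_rfl θ
      rw [zero_add] at this
      rw [hzI this, hx.initial]
    · have hle : ∀ t ∈ Icc 0 b,
          z t = z 0 + ∫ s in (0 : ℝ)..t, f (max s 0 / ε) (delayed r ε z s) := by
        intro t ht
        rw [hzw ht.2, hzw hbpos.le, hwint t ht]
        congr 1
        refine intervalIntegral.integral_congr fun s hs => ?_
        rw [uIcc_of_le ht.1] at hs
        refine congrArg (f _) (delayed_congr fun θ => (hzw ?_).symm)
        have h1 : ε * (θ : ℝ) ≤ 0 := mul_nonpos_of_nonneg_of_nonpos hε.le θ.2.2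
        exact mem_Iic.2 (by linarith [hs.2, ht.2])
      rcases le_total t b with htb | hbt
      · exact hle t ⟨ht.1, htb⟩
      · rw [hzint t ⟨hbt, ht.2⟩, ← hzw self_mem_Iic, hle b ⟨hbpos.le, le_rfl⟩, add_assoc,
          intervalIntegral.integral_add_adjacent_intervals (hcont.intervalIntegrable _ _)
            (hcont.intervalIntegrable _ _)]
  have hIc : I ⊆ Icc (-(ε * r)) c := fun t ht => ⟨hx.subset_Ici ht, (hIb t ht).trans hbc.le⟩
  have hcI : c ∈ I := by
    rw [← hmax z _ hzsol hIc hzI]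
    exact ⟨by linarith, le_rfl⟩
  exact (hIb c hcI).not_gt hbc

/-! ### Averaging along a convergent sequence -/

theorem HasAverage.tendsto_integral {r : ℝ} {f : ℝ → Hist r E → E} {F : Hist r E → E}
    (h : HasAverage f F) (ξ : Hist r E) {s : ℝ} (hs : 0 < s) {ε : ℕ → ℝ} (hε : ∀ n, 0 < ε n)
    (hε0 : Tendsto ε atTop (𝓝 0)) :
    Tendsto (fun n => ε n • ∫ u in (0 : ℝ)..s / ε n, f u ξ) atTop (𝓝 (s • F ξ)) := by
  have hε' : Tendsto ε atTop (𝓝[>] 0) :=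
    tendsto_nhdsWithin_iff.2 ⟨hε0, Eventually.of_forall hε⟩
  have h1 : Tendsto (fun n => s / ε n) atTop atTop := by
    simpa only [div_eq_mul_inv, Pi.inv_apply] using
      hε'.inv_tendsto_nhdsGT_zero.const_mul_atTop hs
  refine (((h ξ).comp h1).const_smul s).congr fun n => ?_
  have := (hε n).ne'
  simp only [Function.comp_apply, smul_smul]
  congr 1
  field_simp

theorem hasDerivAt_smul_integral_div [CompleteSpace E] {r : ℝ} {f : ℝ → Hist r E → E}
    (hf : ContinuousOn (Function.uncurry f) (Ici 0 ×ˢ univ)) (ξ : Hist r E) {ε s : ℝ}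
    (hε : 0 < ε) (hs : 0 < s) :
    HasDerivAt (fun s => ε • ∫ u in (0 : ℝ)..s / ε, f u ξ) (f (s / ε) ξ) s := by
  have hc : ContinuousOn (fun u => f u ξ) (Ici 0) :=
    hf.comp (f := fun u => (u, ξ)) (by fun_prop) fun u hu => ⟨hu, mem_univ _⟩
  have hpos : 0 < s / ε := div_pos hs hε
  have hI : IntervalIntegrable (fun u => f u ξ) MeasureTheory.volume 0 (s / ε) :=
    (hc.mono (by rw [uIcc_of_le hpos.le]; exact Icc_subset_Ici_self)).intervalIntegrable
  have hd := intervalIntegral.integral_hasDerivAt_right hI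
    ((hc.mono Ioi_subset_Ici_self).stronglyMeasurableAtFilter isOpen_Ioi _ hpos)
    (hc.continuousAt (Ici_mem_nhds hpos))
  have hdiv : HasDerivAt (fun s => s / ε) (1 / ε) s := (hasDerivAt_id s).div_const ε
  refine ((hd.scomp s hdiv).const_smul ε).congr_deriv ?_
  rw [smul_smul, mul_one_div_cancel hε.ne', one_smul]

/-- The heart of the averaging argument: on a short interval near `t` and for small `ε`, the history
of a solution is close to the constant history with value `z t`, so by uniform continuity in the
state the increments of the solution are close to those of
`s ↦ ε ∫₀^{s/ε} f(u, z t) du`, which converges to `s • F (z t)`. -/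
theorem exists_norm_increment_le [CompleteSpace E] {r : ℝ} (hr : 0 ≤ r) {f : ℝ → Hist r E → E}
    (hf : ContinuousOn (Function.uncurry f) (Ici 0 ×ˢ univ)) (h1 : UniformlyContinuousInState f)
    {F : Hist r E → E} (h3 : HasAverage f F) {ε : ℕ → ℝ} (hε : ∀ n, 0 < ε n)
    (hε0 : Tendsto ε atTop (𝓝 0)) {u : ℕ → ℝ → E} {K : NNReal} (hu : ∀ n, LipschitzWith K (u n))
    {z : ℝ → E} (huz : ∀ t, Tendsto (fun n => u n t) atTop (𝓝 (z t))) {τ' : ℕ → ℝ} {τ : ℝ}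
    (hτ : Tendsto τ' atTop (𝓝 τ))
    (hderiv : ∀ n s, 0 < s → ε n * r ≤ s → s < τ' n →
      HasDerivAt (u n) (f (s / ε n) (delayed r (ε n) (u n) s)) s)
    (t : ℝ) {η : ℝ} (hη : 0 < η) :
    ∃ ρ > 0, ∀ a b, 0 < a → a < b → b < τ → |a - t| < ρ → |b - t| < ρ →
      ‖z b - z a - (b - a) • averagedField F (z t)‖ ≤ η * (b - a) := by
  let ξ : Hist r E := ContinuousMap.const _ (z t)
  obtain ⟨ρ, hρ, hρf⟩ := h1 ξ η hη
  have hK : (0 : ℝ) ≤ K := K.2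
  refine ⟨ρ / (2 * (K + 1)), by positivity, fun a b ha hab hb hat hbt => ?_⟩
  have hlim : Tendsto (fun n => u n b - u n a -
      ((ε n • ∫ s in (0 : ℝ)..b / ε n, f s ξ) - ε n • ∫ s in (0 : ℝ)..a / ε n, f s ξ)) atTop
      (𝓝 (z b - z a - (b • F ξ - a • F ξ))) :=
    ((huz b).sub (huz a)).sub ((h3.tendsto_integral ξ (ha.trans hab) hε hε0).sub
      (h3.tendsto_integral ξ ha hε hε0))
  rw [← sub_smul] at hlim
  refine le_of_tendsto hlim.norm ?_
  have hsmall : Tendsto (fun n => K * (ε n * r) + ‖u n t - z t‖) atTop (𝓝 0) := by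
    have hA := (hε0.mul_const r).const_mul (K : ℝ)
    have hB := ((huz t).sub_const (z t)).norm
    simpa using hA.add hB
  have hεr : Tendsto (fun n => ε n * r) atTop (𝓝 0) := by simpa using hε0.mul_const r
  filter_upwards [hsmall.eventually_lt_const (half_pos hρ), hεr.eventually_lt_const ha,
    hτ.eventually_const_lt hb] with n hn hna hnb
  have hDer : ∀ s ∈ Icc a b, HasDerivAt
      (fun s => u n s - ε n • ∫ v in (0 : ℝ)..s / ε n, f v ξ)
      (f (s / ε n) (delayed r (ε n) (u n) s) - f (s / ε n) ξ) s := fun s hs =>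
    (hderiv n s (ha.trans_le hs.1) (hna.le.trans hs.1) (hs.2.trans_lt hnb)).sub
      (hasDerivAt_smul_integral_div hf ξ (hε n) (ha.trans_le hs.1))
  have hmv := norm_image_sub_le_of_norm_deriv_le_segment' (C := η)
    (fun s hs => (hDer s hs).hasDerivWithinAt) (fun s hs => ?_) b ⟨hab.le, le_rfl⟩
  · simpa only [sub_sub_sub_comm] using hmv
  · refine (hρf _ ?_ _ (div_nonneg (ha.le.trans hs.1) (hε n).le)).le
    have hst : |s - t| < ρ / (2 * (K + 1)) := by
      rw [abs_lt] at hat hbt ⊢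
      constructor <;> linarith [hs.1, hs.2, hat.1, hbt.2]
    have hKs : K * |s - t| ≤ K * (ρ / (2 * (K + 1))) := by gcongr
    have hlt : K * (ρ / (2 * (K + 1))) < ρ / 2 := by
      rw [mul_div_assoc', div_lt_div_iff₀ (by positivity) two_pos]
      nlinarith
    refine (norm_delayed_sub_const_le (hε n).le (hu n) t s (z t) le_rfl (by
      have := (hε n).le
      positivity)).trans_lt ?_
    rw [mul_add]
    linarith

/-- Limits of solutions as `ε → 0` solve the averaged equation. -/
theorem hasDerivWithinAt_of_tendsto [CompleteSpace E] {r : ℝ} (hr : 0 ≤ r)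
    {f : ℝ → Hist r E → E}
    (hf : ContinuousOn (Function.uncurry f) (Ici 0 ×ˢ univ)) (h1 : UniformlyContinuousInState f)
    {F : Hist r E → E} (h3 : HasAverage f F) {ε : ℕ → ℝ} (hε : ∀ n, 0 < ε n)
    (hε0 : Tendsto ε atTop (𝓝 0)) {u : ℕ → ℝ → E} {K : NNReal} (hu : ∀ n, LipschitzWith K (u n))
    {z : ℝ → E} (hz : Continuous z) (huz : ∀ t, Tendsto (fun n => u n t) atTop (𝓝 (z t)))
    {τ' : ℕ → ℝ} {τ : ℝ} (hτ : Tendsto τ' atTop (𝓝 τ))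
    (hderiv : ∀ n s, 0 < s → ε n * r ≤ s → s < τ' n →
      HasDerivAt (u n) (f (s / ε n) (delayed r (ε n) (u n) s)) s)
    {t : ℝ} (ht : t ∈ Icc 0 τ) :
    HasDerivWithinAt z (averagedField F (z t)) (Icc 0 τ) t := by
  rw [hasDerivWithinAt_iff_isLittleO, Asymptotics.isLittleO_iff]
  intro η hη
  obtain ⟨ρ, hρ, hopen⟩ :=
    exists_norm_increment_le hr hf h1 h3 hε hε0 hu huz hτ hderiv t hη
  -- The estimate extends to `0 ≤ a` and `b ≤ τ` by shrinking the interval slightly.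
  have hclosed : ∀ a b, 0 ≤ a → a < b → b ≤ τ → |a - t| < ρ → |b - t| < ρ →
      ‖z b - z a - (b - a) • averagedField F (z t)‖ ≤ η * (b - a) := by
    intro a b ha hab hb hat hbt
    have hca : Continuous fun l : ℝ => a + l * (b - a) := by fun_prop
    have hcb : Continuous fun l : ℝ => b - l * (b - a) := by fun_prop
    have hL : Continuous fun l : ℝ => ‖z (b - l * (b - a)) - z (a + l * (b - a)) -
        ((b - l * (b - a)) - (a + l * (b - a))) • averagedField F (z t)‖ := by fun_prop
    have hR : Continuous fun l : ℝ => η * ((b - l * (b - a)) - (a + l * (b - a))) := by fun_prop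
    have hL0 := (hL.tendsto 0).mono_left (nhdsWithin_le_nhds (s := Ioi 0))
    have hR0 := (hR.tendsto 0).mono_left (nhdsWithin_le_nhds (s := Ioi 0))
    simp only [zero_mul, sub_zero, add_zero] at hL0 hR0
    refine le_of_tendsto_of_tendsto hL0 hR0 ?_
    filter_upwards [Ioo_mem_nhdsGT (show (0 : ℝ) < 1 / 2 by norm_num)] with l hl
    have hba : 0 < b - a := sub_pos.2 hab
    have hl1 : 0 < l * (b - a) := mul_pos hl.1 hba
    have hl2 : l * (b - a) < 1 / 2 * (b - a) := mul_lt_mul_of_pos_right hl.2 hba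
    rw [abs_lt] at hat hbt
    refine hopen _ _ (by linarith) (by linarith) (by linarith) ?_ ?_ <;> rw [abs_lt] <;>
      constructor <;> linarith [hat.1, hbt.2]
  filter_upwards [self_mem_nhdsWithin,
    mem_nhdsWithin_of_mem_nhds (Metric.ball_mem_nhds t hρ)] with s hs hst
  rw [Metric.mem_ball, Real.dist_eq] at hst
  have htt : |t - t| < ρ := by simpa using hρ
  rcases lt_trichotomy t s with hts | rfl | hts
  · rw [Real.norm_of_nonneg (sub_pos.2 hts).le]
    exact hclosed t s ht.1 hts hs.2 htt hst
  · simp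
  · rw [Real.norm_of_nonpos (sub_neg.2 hts).le, neg_sub, ← norm_neg]
    have hneg : -(z s - z t - (s - t) • averagedField F (z t))
        = z t - z s - (t - s) • averagedField F (z t) := by module
    rw [hneg]
    exact hclosed s t hs.1 hts ht.2 hst htt

/-! ### The first exit from the `δ`-tube around the averaged solution -/

/-- If a noncontinuable solution fails to exist up to time `L` or to stay `δ`-close to `y`, then it
reaches distance `δ` from `y`. Up to the first time `τ` when this happens it is Lipschitz, with a
constant that does not depend on `ε`; the function `u` is the solution with time clamped to
`[0, τ]`. -/
theorem IsMaximalSolution.exists_exit [FiniteDimensional ℝ E] {r ε : ℝ} (hr : 0 ≤ r)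
    (hε : 0 < ε) {f : ℝ → Hist r E → E}
    (hf : ContinuousOn (Function.uncurry f) (Ici 0 ×ˢ univ)) (h2 : UniformlyQuasiBounded f)
    {φ : Hist r E} {x : ℝ → E} {I : Set ℝ} (h : IsMaximalSolution f φ ε x I) {y : ℝ → E}
    {L δ R : ℝ} (hL : 0 ≤ L) (hy : ContinuousOn y (Icc 0 L)) (hφR : ‖φ‖ ≤ R)
    (hyR : ∀ t ∈ Icc 0 L, ‖y t‖ + δ ≤ R) {M : NNReal}
    (hM : ∀ t, 0 ≤ t → ∀ ξ : Hist r E, ‖ξ‖ ≤ R → ‖f t ξ‖ ≤ M)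
    (hbad : ¬ (Icc (-(ε * r)) L ⊆ I ∧ ∀ t ∈ Icc 0 L, ‖x t - y t‖ < δ)) :
    ∃ u : C(ℝ, E), ∃ τ ∈ Icc 0 L, LipschitzWith M u ∧ u 0 = φ ⟨0, neg_nonpos.2 hr, le_rfl⟩ ∧
      δ ≤ ‖u τ - y τ‖ ∧ ∀ s, 0 < s → ε * r ≤ s → s < τ →
        HasDerivAt u (f (s / ε) (delayed r ε u s)) s := by
  have hx := h.1
  have hεr : 0 ≤ ε * r := mul_nonneg hε.le hr
  have h0 := hx.zero_mem hr hε
  have hneg : ∀ t ∈ I, t ≤ 0 → ‖x t‖ ≤ R := by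
    intro t ht ht0
    have hθ : t / ε ∈ Icc (-r) (0 : ℝ) := by
      refine ⟨?_, div_nonpos_of_nonpos_of_nonneg ht0 hε.le⟩
      rw [le_div_iff₀ hε]
      linarith [mem_Ici.1 (hx.subset_Ici ht)]
    have hxt := hx.initial ⟨t / ε, hθ⟩
    simp only [mul_div_cancel₀ _ hε.ne'] at hxt
    rw [hxt]
    exact (φ.norm_coe_le_norm _).trans hφR
  have htube : ∀ t ∈ Icc 0 L, ‖x t - y t‖ ≤ δ → ‖x t‖ ≤ R := by
    intro t ht hd
    have := norm_le_norm_add_norm_sub' (x t) (y t)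
    linarith [hyR t ht]
  obtain ⟨t₁, ht₁I, ht₁, hd₁⟩ : ∃ t ∈ I, t ∈ Icc 0 L ∧ δ ≤ ‖x t - y t‖ := by
    by_contra! hno
    have hLI : L ∈ I := h.mem_of_bounded hr hε hf h2 hL fun t ht htL => by
      rcases le_total t 0 with ht0 | h0t
      · exact hneg t ht ht0
      · exact htube t ⟨h0t, htL⟩ (hno t ht ⟨h0t, htL⟩).le
    have hsub := hx.Icc_subset hLI
    exact hbad ⟨hsub, fun t ht => hno t (hsub ⟨by linarith [ht.1], ht.2⟩) ht⟩
  have hsub₁ : Icc 0 t₁ ⊆ I :=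
    (Icc_subset_Icc_left (by linarith)).trans (hx.Icc_subset ht₁I)
  have hcont : ContinuousOn (fun t => ‖x t - y t‖) (Icc 0 t₁) :=
    ((hx.continuousOn.mono hsub₁).sub (hy.mono (Icc_subset_Icc_right ht₁.2))).norm
  have hcpt : IsCompact (Icc 0 t₁ ∩ (fun t => ‖x t - y t‖) ⁻¹' Ici δ) :=
    isCompact_Icc.of_isClosed_subset (hcont.preimage_isClosed_of_isClosed isClosed_Icc isClosed_Ici)
      inter_subset_left
  obtain ⟨τ, ⟨hτ, hdτ⟩, hmin⟩ := hcpt.exists_isLeast ⟨t₁, ⟨ht₁.1, le_rfl⟩, hd₁⟩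
  have hτL : τ ≤ L := hτ.2.trans ht₁.2
  have hsubτ : Icc 0 τ ⊆ I := (Icc_subset_Icc_right hτ.2).trans hsub₁
  have hlt : ∀ t ∈ Ico 0 τ, ‖x t - y t‖ ≤ δ := by
    intro t ht
    by_contra! hgt
    exact (hmin ⟨⟨ht.1, ht.2.le.trans hτ.2⟩, hgt.le⟩).not_gt ht.2
  -- The tube estimate extends to time `τ` by continuity, except when `τ = 0`, where the bound on
  -- the solution comes from the initial function.
  have hbound : ∀ t ∈ I, t ≤ τ → ‖x t‖ ≤ R := by
    intro t ht htτ
    rcases le_or_gt t 0 with ht0 | h0t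
    · exact hneg t ht ht0
    · have hle : ∀ s ∈ Icc 0 τ, ‖x s - y s‖ ≤ δ := by
        intro s hs
        have hτ0 : (0 : ℝ) ≠ τ := (h0t.trans_le htτ).ne
        exact ContinuousWithinAt.closure_le (s := Ico 0 τ) (by rwa [closure_Ico hτ0])
          ((hcont s ⟨hs.1, hs.2.trans hτ.2⟩).mono
            (Ico_subset_Icc_self.trans (Icc_subset_Icc_right hτ.2)))
          continuousWithinAt_const hlt
      exact htube t ⟨h0t.le, htτ.trans hτL⟩ (hle t ⟨h0t.le, htτ⟩)
  have hLip := hx.lipschitzOnWith hε ((norm_nonneg _).trans hφR) hbound hM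
  rw [inter_eq_right.2 hsubτ] at hLip
  let u : ℝ → E := fun t => x (projIcc 0 τ hτ.1 t)
  have huL : LipschitzWith M u := by
    have := (hLip.to_restrict).comp (LipschitzWith.projIcc hτ.1)
    rwa [mul_one] at this
  have hux : EqOn u x (Icc 0 τ) := fun t ht => by simp only [u, projIcc_of_mem hτ.1 ht]
  refine ⟨⟨u, huL.continuous⟩, τ, ⟨hτ.1, hτL⟩, huL, ?_, ?_, fun s hs hrs hsτ => ?_⟩
  · have hi := hx.initial ⟨0, neg_nonpos.2 hr, le_rfl⟩
    rw [mul_zero] at hi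
    exact (hux ⟨le_rfl, hτ.1⟩).trans hi
  · simpa only [ContinuousMap.coe_mk, hux ⟨hτ.1, le_rfl⟩, mem_preimage, mem_Ici] using hdτ
  · have hd : delayed r ε u s = delayed r ε x s := by
      refine delayed_congr fun θ => hux ⟨?_, ?_⟩
      · nlinarith [θ.2.1]
      · nlinarith [θ.2.2]
    simp only [ContinuousMap.coe_mk, hd]
    exact hx.hasDerivAt (hsubτ ⟨hτ.1, le_rfl⟩) hs hsτ hεr hux

end RFDEAveraging

end

/-! ### The averaging theorem -/

theorem theorem2p4 {E : Type*} [NormedAddCommGroup E] [NormedSpace ℝ E] [FiniteDimensional ℝ E]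
    (r : ℝ) (hr : 0 ≤ r)
    (f : ℝ → RFDEAveraging.Hist r E → E)
    (hf : ContinuousOn (Function.uncurry f) (Set.Ici 0 ×ˢ Set.univ))
    (φ : RFDEAveraging.Hist r E)
    (h1 : RFDEAveraging.UniformlyContinuousInState f)
    (h2 : RFDEAveraging.UniformlyQuasiBounded f)
    (F : RFDEAveraging.Hist r E → E)
    (h3 : RFDEAveraging.HasAverage f F)
    (h4 : RFDEAveraging.HasUniqueODESolution (RFDEAveraging.averagedField F)
      (φ ⟨0, neg_nonpos.2 hr, le_rfl⟩))
    (y : ℝ → E) (J : Set ℝ)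
    (hy : RFDEAveraging.IsMaximalODESolution (RFDEAveraging.averagedField F)
      (φ ⟨0, neg_nonpos.2 hr, le_rfl⟩) y J)
    (L : ℝ) (hL : L ∈ J) (δ : ℝ) (hδ : 0 < δ) :
    ∃ ε₀ : ℝ, 0 < ε₀ ∧ ∀ ε ∈ Set.Ioc 0 ε₀, ∀ (x : ℝ → E) (I : Set ℝ),
      RFDEAveraging.IsMaximalSolution f φ ε x I →
        Set.Icc (-(ε * r)) L ⊆ I ∧ ∀ t ∈ Set.Icc 0 L, ‖x t - y t‖ < δ := by
  have := FiniteDimensional.complete ℝ E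
  have hy' := hy.1
  have hL0 : 0 ≤ L := hy'.subset_Ici hL
  have hJ : Icc 0 L ⊆ J := hy'.ordConnected.out hy'.zero_mem hL
  have hyc : ContinuousOn y (Icc 0 L) := fun t ht =>
    (hy'.hasDeriv t (hJ ht)).continuousWithinAt.mono hJ
  obtain ⟨C, hC⟩ := isCompact_Icc.exists_bound_of_continuousOn hyc
  set R : ℝ := max ‖φ‖ (C + δ)
  obtain ⟨M, hM⟩ := h2 _ (Metric.isBounded_closedBall (x := (0 : RFDEAveraging.Hist r E)) (r := R))
  by_contra! hcon
  let e : ℕ → ℝ := fun n => 1 / ((n : ℝ) + 1)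
  have he : ∀ n, 0 < e n := fun n => Nat.one_div_pos_of_nat
  choose ε hε x I hx hbad using fun n => hcon (e n) (he n)
  have hεpos : ∀ n, 0 < ε n := fun n => (hε n).1
  have hε0 : Tendsto ε atTop (𝓝 0) :=
    squeeze_zero (fun n => (hεpos n).le) (fun n => (hε n).2) tendsto_one_div_add_atTop_nhds_zero_nat
  choose u τ hτ huL hu0 hud huderiv using fun n =>
    (hx n).exists_exit (R := R) (M := M.toNNReal) hr (hεpos n) hf h2 hL0 hyc (le_max_left _ _)
      (fun t ht => (add_le_add_left (hC t ht) δ).trans (le_max_right _ _))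
      (fun t ht ξ hξ => (hM t ht ξ (mem_closedBall_zero_iff.2 hξ)).trans (Real.le_coe_toNNReal M))
      (fun hgood => by
        obtain ⟨t, ht, hle⟩ := hbad n hgood.1
        exact hle.not_gt (hgood.2 t ht))
  obtain ⟨⟨z, σ⟩, ⟨⟨hzL, hz0⟩, hσ⟩, ψ, hψ, hlim⟩ :=
    ((RFDEAveraging.isCompact_setOf_lipschitzWith M.toNNReal 0
      (φ ⟨0, neg_nonpos.2 hr, le_rfl⟩)).prod (isCompact_Icc (a := 0) (b := L))).tendsto_subseq
      (x := fun n => (u n, τ n)) fun n => ⟨⟨huL n, hu0 n⟩, hτ n⟩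
  simp only at hzL hz0 hσ
  have hlimu : Tendsto (fun n => u (ψ n)) atTop (𝓝 z) := (continuous_fst.tendsto _).comp hlim
  have hlimτ : Tendsto (fun n => τ (ψ n)) atTop (𝓝 σ) := (continuous_snd.tendsto _).comp hlim
  -- Evaluation is jointly continuous on `C(ℝ, E) × ℝ`, so the exit estimate survives the limit.
  have hexit : δ ≤ ‖z σ - y σ‖ := by
    have hzσ : Tendsto (fun n => u (ψ n) (τ (ψ n))) atTop (𝓝 (z σ)) :=
      ((continuous_eval (F := C(ℝ, E))).tendsto (z, σ)).comp (hlimu.prodMk_nhds hlimτ)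
    have hyσ : Tendsto (fun n => y (τ (ψ n))) atTop (𝓝 (y σ)) :=
      (hyc σ hσ).tendsto.comp (tendsto_nhdsWithin_iff.2
        ⟨hlimτ, Eventually.of_forall fun n => hτ (ψ n)⟩)
    exact ge_of_tendsto' (hzσ.sub hyσ).norm fun n => hud (ψ n)
  have hzy : z σ = y σ := by
    rcases hσ.1.eq_or_lt with h0 | hpos
    · rw [← h0, hz0, hy'.initial]
    · refine h4.2 z (Icc 0 σ) y J ⟨ordConnected_Icc, Icc_subset_Ici_self, ⟨le_rfl, hσ.1⟩,
        ⟨σ, ⟨hσ.1, le_rfl⟩, hpos⟩, hz0, fun t ht => ?_⟩ hy' ⟨⟨hσ.1, le_rfl⟩, hJ hσ⟩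
      exact RFDEAveraging.hasDerivWithinAt_of_tendsto hr hf h1 h3 (fun n => hεpos (ψ n))
        (hε0.comp hψ.tendsto_atTop) (fun n => huL (ψ n)) z.continuous
        (fun s => ((continuous_eval_const (F := C(ℝ, E)) s).tendsto z).comp hlimu) hlimτ
        (fun n => huderiv (ψ n)) ht
  rw [hzy, sub_self, norm_zero] at hexit
  exact hexit.not_gt hδ
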